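/- Let $\mathcal H$ be a complex Hilbert space. A contraction is a bounded linear operator $T$ on $\mathcal H$ with $\|T\|\le 1$; its defect operator is $D_T=(I-T^*T)^{1/2}$ and its defect space is $\mathcal D_T=\overline{D_T\mathcal H}$. Write $\Re A=\tfrac12(A+A^*)$. For contractions $T,T'$ on $\mathcal H$: - $T$ is Harnack dominated by $T'$ if there is a constant $c\ge 1$ such that $\Re p(T)\le c\,\Re p(T')$ for every complex polynomial $p$ with $\Re p(z)\ge 0$ for all $|z|\le 1$; $T$ and $T'$ are Harnack equivalent if each is Harnack dominated by the other. - $T$ is Shmul'yan dominated by $T'$ if $T=T'+D_{T'^*}XD_{T'}$ for some bounded operator $X:\mathcal D_{T'}\to\mathcal D_{T'^*}$; $T$ and $T'$ are Shmul'yan equivalent if each is Shmul'yan dominated by the other. - $T$ and $T'$ are doubly commuting if $T$ commutes with $T'$ and with $T'^*$; $T$ is quasi-normal if $T$ commutes with $T^*T$. Let $T$ and $T'$ be doubly commuting contractions on $\mathcal H$ such that $T$ is quasi-normal and $T$ is Harnack dominated by $T'$. Then $T$ and $T'$ are Shmul'yan equivalent, and hence Harnack equivalent. In particular, if $T$ and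 $T'$ are commuting normal contractions on $\mathcal H$ and $T$ is Harnack dominated by $T'$, then $T$ and $T'$ are Shmul'yan equivalent, and hence Harnack equivalent. -/

import Mathlib

noncomputable section

open ContinuousLinearMap
open scoped ComplexStarModule

/-- `T` is Harnack dominated by `T'`: there is `c ≥ 1` such that `Re p(T) ≤ c Re p(T')` in the
Loewner order, for every complex polynomial `p` with `Re p ≥ 0` on the closed unit disc. Here
`ℜ A` is Mathlib's real part `(1/2)(A + A*)`. -/
def HarnackDominated {H : Type*} [NormedAddCommGroup H] [InnerProductSpace ℂ H] [CompleteSpace H]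
    (T T' : H →L[ℂ] H) : Prop :=
  ∃ c : ℝ, 1 ≤ c ∧ ∀ p : Polynomial ℂ, (∀ z : ℂ, ‖z‖ ≤ 1 → 0 ≤ (p.eval z).re) →
    (ℜ (Polynomial.aeval T p) : H →L[ℂ] H) ≤ c • (ℜ (Polynomial.aeval T' p) : H →L[ℂ] H)

/-- Harnack equivalence: Harnack domination in both directions. -/
def HarnackEquivalent {H : Type*} [NormedAddCommGroup H] [InnerProductSpace ℂ H] [CompleteSpace H]
    (T T' : H →L[ℂ] H) : Prop :=
  HarnackDominated T T' ∧ HarnackDominated T' T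

section Defect

variable {H₁ H₂ : Type*} [NormedAddCommGroup H₁] [InnerProductSpace ℂ H₁] [CompleteSpace H₁]
  [NormedAddCommGroup H₂] [InnerProductSpace ℂ H₂] [CompleteSpace H₂]

/-- The defect operator `D_T = (I - T* T)^{1/2}` (the positive square root; meant for `‖T‖ ≤ 1`). -/
def defectOp (T : H₁ →L[ℂ] H₂) : H₁ →L[ℂ] H₁ :=
  CFC.sqrt (1 - adjoint T ∘L T)

/-- The defect space of `T`: the closure of the range of `D_T`. -/
def defectSpace (T : H₁ →L[ℂ] H₂) : Submodule ℂ H₁ :=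
  (defectOp T).range.topologicalClosure

/-- The defect operator, viewed as an operator from the whole space into the defect space. -/
def defectOpTo (T : H₁ →L[ℂ] H₂) : H₁ →L[ℂ] defectSpace T :=
  (defectOp T).codRestrict (defectSpace T) fun x =>
    Submodule.le_topologicalClosure _ ⟨x, rfl⟩

/-- The defect operator, viewed as an operator from the defect space into the whole space. -/
def defectOpFrom (T : H₁ →L[ℂ] H₂) : defectSpace T →L[ℂ] H₁ :=
  defectOp T ∘L (defectSpace T).subtypeL

/-- `B` is Shmul'yan dominated by `A`: `B = A + D_{A*} X D_A` for some bounded operator `X` from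
the defect space of `A` to the defect space of `A*`. -/
def ShmulyanDominated (B A : H₁ →L[ℂ] H₂) : Prop :=
  ∃ X : defectSpace A →L[ℂ] defectSpace (adjoint A),
    B = A + defectOpFrom (adjoint A) ∘L X ∘L defectOpTo A

/-- Shmul'yan equivalence: Shmul'yan domination in both directions. -/
def ShmulyanEquivalent (A B : H₁ →L[ℂ] H₂) : Prop :=
  ShmulyanDominated A B ∧ ShmulyanDominated B A

end Defect

/-- `A` and `B` doubly commute: `A` commutes with `B` and with `B*`. -/
def DoublyCommute {H : Type*} [NormedAddCommGroup H] [InnerProductSpace ℂ H] [CompleteSpace H]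
    (A B : H →L[ℂ] H) : Prop :=
  Commute A B ∧ Commute A (adjoint B)

/-- `A` is quasi-normal: `A` commutes with `A* A`. -/
def IsQuasiNormal {H : Type*} [NormedAddCommGroup H] [InnerProductSpace ℂ H] [CompleteSpace H]
    (A : H →L[ℂ] H) : Prop :=
  Commute A (adjoint A * A)

end

/-!
The Poisson kernel `P(S) = (1 - S)⁻¹ + (1 - S*)⁻¹ - 1` of a strict contraction satisfies
`⟪y - S y, P(S) (y - S y)⟫ = ‖D_S y‖²`. Harnack domination of `T` by `T'` amounts to
`P(z T) ≤ c P(z T')` on the open unit disc: one direction tests on truncations of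
`(1 + z w) / (1 - z w)`, the other integrates against `Re p` over circles.

Work with `S = r T`, `S' = r T'` and let `r → 1` at the end. Testing the inequality on the circle
at `y - ζ S' y`, the maximum principle for `ζ ↦ D_S (1 - ζ S)⁻¹ (y - ζ S' y)` gives
`‖D_S y‖² ≤ c ‖D_S' y‖²`. Averaging it over the circle at the vectors `(1 - ζ S)⁻¹ u` is where the
commutation hypotheses enter: by Cauchy's theorem both averages are explicit in `S* S` and `S* S'`,
and for `u = (1 - S* S)(1 - S* S') x` they yield `‖(1 - S* S') x‖ ≤ 2 c ‖(1 - S* S) x‖`.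
Since `D_T` commutes with `T* T'`, this becomes
`|⟪(1 - T* T') x, y⟫| ≤ 2 c ‖D_T x‖ ‖D_T y‖`, and the identity
`T' - T = (1 - T T*) T' - T (1 - T* T')` turns it into `|⟪(T' - T) x, y⟫| ≤ 4 c ‖D_T x‖ ‖D_T* y‖`,
which is Shmul'yan domination of `T'` by `T`. The comparison of defect operators gives the
converse domination.

That Shmul'yan equivalence implies Harnack equivalence needs no commutation: the form estimate on
`T' - T`, with one defect operator taken from each contraction, passes to `z T` and `z T'`, and the
resolvent identity bounds `D_S' (1 - S')⁻¹` by a multiple of `D_S (1 - S)⁻¹`.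
-/

open ContinuousLinearMap
open scoped ComplexStarModule

section Contraction

variable {E F : Type*} [NormedAddCommGroup E] [InnerProductSpace ℂ E] [CompleteSpace E]
  [NormedAddCommGroup F] [InnerProductSpace ℂ F] [CompleteSpace F]

theorem norm_adjoint_le_one {T : E →L[ℂ] F} (hT : ‖T‖ ≤ 1) : ‖adjoint T‖ ≤ 1 := by
  rwa [LinearIsometryEquiv.norm_map]

theorem one_sub_adjoint_comp_self_nonneg {T : E →L[ℂ] F} (hT : ‖T‖ ≤ 1) :
    0 ≤ 1 - adjoint T ∘L T := by
  refine nonneg_iff_isPositive _ |>.mpr <| isPositive_def'.mpr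
    ⟨(IsSelfAdjoint.one _).sub (isPositive_adjoint_comp_self T).isSelfAdjoint, fun x => ?_⟩
  rw [reApplyInnerSelf_apply, sub_apply, inner_sub_left, map_sub, one_apply_eq_self, comp_apply,
    adjoint_inner_left, inner_self_eq_norm_sq, inner_self_eq_norm_sq, sub_nonneg]
  gcongr
  exact (T.le_of_opNorm_le hT x).trans_eq (one_mul _)

theorem isSelfAdjoint_defectOp (T : E →L[ℂ] F) : IsSelfAdjoint (defectOp T) :=
  (CFC.sqrt_nonneg _).isSelfAdjoint

theorem defectOp_defectOp_apply {T : E →L[ℂ] F} (hT : ‖T‖ ≤ 1) (x : E) :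
    defectOp T (defectOp T x) = x - adjoint T (T x) :=
  DFunLike.congr_fun (CFC.sqrt_mul_sqrt_self _ (one_sub_adjoint_comp_self_nonneg hT)) x

theorem inner_defectOp_left (T : E →L[ℂ] F) (x y : E) :
    inner ℂ (defectOp T x) y = inner ℂ x (defectOp T y) :=
  (isSelfAdjoint_defectOp T).isSymmetric x y

theorem norm_defectOp_sq {T : E →L[ℂ] F} (hT : ‖T‖ ≤ 1) (x : E) :
    ‖defectOp T x‖ ^ 2 = ‖x‖ ^ 2 - ‖T x‖ ^ 2 := by
  rw [← inner_self_eq_norm_sq (𝕜 := ℂ), inner_defectOp_left, defectOp_defectOp_apply hT,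
    inner_sub_right, adjoint_inner_right, map_sub, inner_self_eq_norm_sq, inner_self_eq_norm_sq]

theorem norm_defectOp_le {T : E →L[ℂ] F} (hT : ‖T‖ ≤ 1) (x : E) : ‖defectOp T x‖ ≤ ‖x‖ := by
  refine le_of_sq_le_sq ?_ (norm_nonneg _)
  rw [norm_defectOp_sq hT]
  exact sub_le_self _ (sq_nonneg _)

theorem commute_defectOp {T : E →L[ℂ] F} {A : E →L[ℂ] E} (h : Commute A (adjoint T ∘L T)) :
    Commute A (defectOp T) :=
  (((Commute.one_right A).sub_right h).symm.cfcₙ_nnreal _).symm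

theorem norm_defectOp_adjoint_apply_le {T : E →L[ℂ] F} (hT : ‖T‖ ≤ 1) (x : E) :
    ‖defectOp (adjoint T) (T x)‖ ≤ ‖defectOp T x‖ := by
  refine le_of_sq_le_sq ?_ (norm_nonneg _)
  have h : ‖x - adjoint T (T x)‖ ^ 2 = ‖x‖ ^ 2 - 2 * ‖T x‖ ^ 2 + ‖adjoint T (T x)‖ ^ 2 := by
    rw [norm_sub_sq (𝕜 := ℂ), adjoint_inner_right, inner_self_eq_norm_sq]
  rw [norm_defectOp_sq (norm_adjoint_le_one hT), norm_defectOp_sq hT]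
  linarith [sq_nonneg ‖x - adjoint T (T x)‖]

end Contraction

section Shmulyan

variable {E F : Type*} [NormedAddCommGroup E] [InnerProductSpace ℂ E] [CompleteSpace E]
  [NormedAddCommGroup F] [InnerProductSpace ℂ F] [CompleteSpace F] {A B : E →L[ℂ] F}

instance (T : E →L[ℂ] F) : CompleteSpace (defectSpace T) :=
  (Submodule.isClosed_topologicalClosure _).completeSpace_coe

theorem denseRange_defectOpTo (T : E →L[ℂ] F) : DenseRange (defectOpTo T) := fun y => by
  rw [Topology.IsInducing.subtypeVal.closure_eq_preimage_closure_image, Set.mem_preimage,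
    ← Set.range_comp]
  exact y.2

theorem adjoint_defectOpTo (T : E →L[ℂ] F) : adjoint (defectOpTo T) = defectOpFrom T := by
  symm
  rw [eq_adjoint_iff]
  exact fun x y => inner_defectOp_left T x y

theorem exists_comp_defectOpTo_eq {G : Type*} [NormedAddCommGroup G] [NormedSpace ℂ G]
    [CompleteSpace G] (T : E →L[ℂ] F) (L : E →L[ℂ] G) (C : ℝ)
    (h : ∀ x, ‖L x‖ ≤ C * ‖defectOp T x‖) :
    ∃ X : defectSpace T →L[ℂ] G, X ∘L defectOpTo T = L :=
  ⟨(L : E →ₗ[ℂ] G).extendOfNorm (defectOpTo T : E →ₗ[ℂ] defectSpace T), by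
    ext x
    exact LinearMap.extendOfNorm_eq (e := (defectOpTo T : E →ₗ[ℂ] defectSpace T))
      (denseRange_defectOpTo T) ⟨C, h⟩ x⟩

theorem norm_le_of_forall_norm_inner_le {E : Type*} [NormedAddCommGroup E]
    [InnerProductSpace ℂ E] {x : E} {M : ℝ} (hM : 0 ≤ M)
    (h : ∀ y, ‖inner ℂ x y‖ ≤ M * ‖y‖) : ‖x‖ ≤ M := by
  rw [← innerSL_apply_norm ℂ x]
  exact opNorm_le_bound _ hM h

theorem shmulyanDominated_of_norm_inner_le (hA : ‖A‖ ≤ 1) {C : ℝ} (hC : 0 ≤ C)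
    (h : ∀ x y, ‖inner ℂ ((B - A) x) y‖ ≤ C * ‖defectOp A x‖ * ‖defectOp (adjoint A) y‖) :
    ShmulyanDominated B A := by
  obtain ⟨X, hX⟩ : ∃ X : defectSpace A →L[ℂ] F, X ∘L defectOpTo A = B - A :=
    exists_comp_defectOpTo_eq A (B - A) C fun x =>
      norm_le_of_forall_norm_inner_le (by positivity) fun y => (h x y).trans <| by
        gcongr
        exact norm_defectOp_le (norm_adjoint_le_one hA) y
  have norm_inner_X (v : defectSpace A) (y : F) :
      ‖inner ℂ (X v) y‖ ≤ C * ‖v‖ * ‖defectOp (adjoint A) y‖ :=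
    (denseRange_defectOpTo A).induction_on v (isClosed_le (by fun_prop) (by fun_prop)) fun x => by
      rw [← comp_apply, hX]
      exact h x y
  obtain ⟨Y, hY⟩ : ∃ Y : defectSpace (adjoint A) →L[ℂ] defectSpace A,
      Y ∘L defectOpTo (adjoint A) = adjoint X :=
    exists_comp_defectOpTo_eq (adjoint A) (adjoint X) C fun y =>
      norm_le_of_forall_norm_inner_le (by positivity) fun v => by
        rw [adjoint_inner_left, norm_inner_symm]
        exact (norm_inner_X v y).trans_eq (by ring)
  refine ⟨adjoint Y, ?_⟩
  rw [← comp_assoc, ← adjoint_defectOpTo, ← adjoint_comp, hY, adjoint_adjoint, hX]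
  abel

namespace ShmulyanDominated

theorem exists_norm_inner_le (h : ShmulyanDominated B A) :
    ∃ C, 0 ≤ C ∧ ∀ x y,
      ‖inner ℂ ((B - A) x) y‖ ≤ C * ‖defectOp A x‖ * ‖defectOp (adjoint A) y‖ := by
  obtain ⟨X, rfl⟩ := h
  refine ⟨‖X‖, norm_nonneg X, fun x y => ?_⟩
  rw [add_sub_cancel_left, ← adjoint_defectOpTo, comp_apply, adjoint_inner_left, comp_apply]
  refine (norm_inner_le_norm _ _).trans ?_
  gcongr
  · exact X.le_opNorm _
  · exact le_rfl

protected theorem adjoint (h : ShmulyanDominated B A) (hA : ‖A‖ ≤ 1) :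
    ShmulyanDominated (adjoint B) (adjoint A) := by
  obtain ⟨C, hC, hBA⟩ := h.exists_norm_inner_le
  refine shmulyanDominated_of_norm_inner_le (norm_adjoint_le_one hA) hC fun y x => ?_
  rw [← map_sub, adjoint_inner_left, norm_inner_symm, adjoint_adjoint]
  exact (hBA x y).trans_eq (by ring)

theorem exists_norm_defectOp_le (h : ShmulyanDominated B A) (hA : ‖A‖ ≤ 1) (hB : ‖B‖ ≤ 1) :
    ∃ K, 1 ≤ K ∧ ∀ x, ‖defectOp B x‖ ≤ K * ‖defectOp A x‖ := by
  obtain ⟨C, hC, hBA⟩ := h.exists_norm_inner_le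
  refine ⟨1 + C, by linarith, fun x => le_of_sq_le_sq ?_ (by positivity)⟩
  have expand : ‖B x‖ ^ 2 =
      ‖A x‖ ^ 2 + 2 * (inner ℂ ((B - A) x) (A x)).re + ‖(B - A) x‖ ^ 2 := by
    rw [show B x = (B - A) x + A x by simp, norm_add_sq (𝕜 := ℂ), RCLike.re_to_complex]
    ring
  have cross : -(C * ‖defectOp A x‖ * ‖defectOp A x‖) ≤ (inner ℂ ((B - A) x) (A x)).re := by
    refine (abs_le.mp ((Complex.abs_re_le_norm _).trans ((hBA x (A x)).trans ?_))).1
    gcongr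
    exact norm_defectOp_adjoint_apply_le hA x
  rw [norm_defectOp_sq hB, mul_pow]
  linarith [norm_defectOp_sq hA x, sq_nonneg ‖(B - A) x‖, sq_nonneg (C * ‖defectOp A x‖)]

end ShmulyanDominated

end Shmulyan

section Resolvent

open Metric Real
open scoped Ring

variable {R : Type*} [NormedRing R] [NormedAlgebra ℂ R] [CompleteSpace R] {a x : R} {z : ℂ}

theorem norm_smul_lt_one {E : Type*} [SeminormedAddCommGroup E] [NormedSpace ℂ E] {v : E}
    (hv : ‖v‖ < 1) (hz : ‖z‖ ≤ 1) : ‖z • v‖ < 1 :=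
  (norm_smul_le z v).trans_lt <| (mul_le_of_le_one_left (norm_nonneg v) hz).trans_lt hv

theorem isUnit_one_sub_smul (ha : ‖a‖ < 1) (hz : ‖z‖ ≤ 1) : IsUnit (1 - z • a) :=
  isUnit_one_sub_of_norm_lt_one (norm_smul_lt_one ha hz)

theorem differentiableAt_inverse_one_sub_smul (ha : ‖a‖ < 1) (hz : ‖z‖ ≤ 1) :
    DifferentiableAt ℂ (fun ζ : ℂ => (1 - ζ • a)⁻¹ʳ) z :=
  (differentiableAt_inverse (isUnit_one_sub_smul ha hz)).comp z
    ((differentiableAt_id.smul_const a).const_sub 1)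

theorem differentiableOn_inverse_one_sub_smul_closedBall (ha : ‖a‖ < 1) :
    DifferentiableOn ℂ (fun ζ : ℂ => (1 - ζ • a)⁻¹ʳ) (closedBall 0 1) := fun _ hz =>
  (differentiableAt_inverse_one_sub_smul ha
    (mem_closedBall_zero_iff.mp hz)).differentiableWithinAt

theorem continuousOn_inverse_one_sub_smul (ha : ‖a‖ < 1) :
    ContinuousOn (fun ζ : ℂ => (1 - ζ • a)⁻¹ʳ) (sphere 0 1) :=
  (differentiableOn_inverse_one_sub_smul_closedBall ha).continuousOn.mono sphere_subset_closedBall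

theorem continuousOn_inverse_one_sub_inv_smul (ha : ‖a‖ < 1) :
    ContinuousOn (fun ζ : ℂ => (1 - ζ⁻¹ • a)⁻¹ʳ) (sphere 0 1) :=
  (continuousOn_inverse_one_sub_smul ha).comp
    (continuousOn_inv₀.mono fun ζ hζ => ne_zero_of_mem_unit_sphere ⟨ζ, hζ⟩)
    fun ζ hζ => by simpa using hζ

theorem circleAverage_eq_of_differentiableOn {E : Type*} [NormedAddCommGroup E] [NormedSpace ℂ E]
    [CompleteSpace E] {f : ℂ → E} (hf : DifferentiableOn ℂ f (closedBall 0 1)) :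
    circleAverage f 0 1 = f 0 := by
  refine DiffContOnCl.circleAverage (DifferentiableOn.diffContOnCl ?_)
  rwa [abs_one, closure_ball _ one_ne_zero]

theorem circleAverage_inverse_one_sub_smul (ha : ‖a‖ < 1) :
    circleAverage (fun ζ : ℂ => (1 - ζ • a)⁻¹ʳ) 0 1 = 1 := by
  rw [circleAverage_eq_of_differentiableOn (differentiableOn_inverse_one_sub_smul_closedBall ha)]
  simp

theorem circleAverage_inverse_one_sub_inv_smul (ha : ‖a‖ < 1) :
    circleAverage (fun ζ : ℂ => (1 - ζ⁻¹ • a)⁻¹ʳ) 0 1 = 1 :=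
  circleAverage_zero_one_congr_inv.trans (circleAverage_inverse_one_sub_smul ha)

theorem circleAverage_mul_left (f : ℂ → R) (c : R) (hf : CircleIntegrable f 0 1) :
    circleAverage (fun ζ => c * f ζ) 0 1 = c * circleAverage f 0 1 :=
  (ContinuousLinearMap.mul ℝ R c).circleAverage_comp_comm hf

theorem one_sub_mul_mul_inverse_mul_inverse (ha : ‖a‖ < 1) (hx : ‖x‖ < 1)
    (hax : Commute (a * x) a) (hz : ‖z‖ = 1) :
    (1 - a * x) * ((1 - z⁻¹ • a)⁻¹ʳ * (1 - z • x)⁻¹ʳ) =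
      (1 - z⁻¹ • a)⁻¹ʳ + (1 - z • x)⁻¹ʳ - 1 := by
  have hz0 : z ≠ 0 := fun h => by simp [h] at hz
  have hU : IsUnit (1 - z⁻¹ • a) := isUnit_one_sub_smul ha (by simp [hz])
  have hV : IsUnit (1 - z • x) := isUnit_one_sub_smul hx hz.le
  have comm : (1 - a * x) * (1 - z⁻¹ • a) = (1 - z⁻¹ • a) * (1 - a * x) :=
    ((Commute.one_right _).sub_right
      (((Commute.one_left a).sub_left hax).smul_right z⁻¹)).eq
  have factor : 1 - a * x = (1 - z • x) + (1 - z⁻¹ • a) - (1 - z⁻¹ • a) * (1 - z • x) := by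
    simp only [sub_mul, mul_sub, one_mul, mul_one, smul_mul_smul_comm, inv_mul_cancel₀ hz0,
      one_smul]
    abel
  refine hU.mul_left_cancel ?_
  rw [← mul_assoc, ← comm, mul_assoc, Ring.mul_inverse_cancel_left _ _ hU, factor, sub_mul, add_mul,
    mul_assoc, mul_sub, mul_add, Ring.mul_inverse_cancel _ hV, Ring.mul_inverse_cancel _ hU]

theorem circleAverage_inverse_mul_inverse_mul (ha : ‖a‖ < 1) (hx : ‖x‖ < 1)
    (hax : Commute (a * x) a) {g : ℂ → R} (hg : DifferentiableOn ℂ g (closedBall 0 1)) :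
    circleAverage (fun ζ => (1 - ζ⁻¹ • a)⁻¹ʳ * ((1 - ζ • x)⁻¹ʳ * g ζ)) 0 1 =
      (1 - a * x)⁻¹ʳ * circleAverage (fun ζ => (1 - ζ⁻¹ • a)⁻¹ʳ * g ζ) 0 1 := by
  have hax1 : ‖a * x‖ < 1 := (norm_mul_le a x).trans_lt (mul_lt_one_of_nonneg_of_lt_one_left
    (norm_nonneg a) ha hx.le)
  have hA := continuousOn_inverse_one_sub_inv_smul ha
  have hB := continuousOn_inverse_one_sub_smul hx
  have hgc : ContinuousOn g (sphere 0 1) := hg.continuousOn.mono sphere_subset_closedBall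
  have holomorphic_part :
      circleAverage (fun ζ : ℂ => ((1 - ζ • x)⁻¹ʳ - 1) * g ζ) 0 1 = 0 := by
    rw [circleAverage_eq_of_differentiableOn
      (((differentiableOn_inverse_one_sub_smul_closedBall hx).sub_const 1).fun_mul hg)]
    simp
  symm
  rw [Ring.inverse_mul_eq_iff_eq_mul _ _ _ (isUnit_one_sub_of_norm_lt_one hax1),
    ← circleAverage_mul_left _ _ ((hA.fun_mul (hB.fun_mul hgc)).circleIntegrable zero_le_one),
    ← add_zero (circleAverage _ 0 1), ← holomorphic_part,
    ← circleAverage_fun_add ((hA.fun_mul hgc).circleIntegrable zero_le_one)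
      (((hB.fun_sub continuousOn_const).fun_mul hgc).circleIntegrable zero_le_one)]
  refine circleAverage_congr_sphere fun ζ hζ => ?_
  have hζ1 : ‖ζ‖ = 1 := by simpa using hζ
  simp only [← mul_assoc]
  rw [mul_assoc (1 - a * x), one_sub_mul_mul_inverse_mul_inverse ha hx hax hζ1, ← add_mul,
    add_sub_assoc]

theorem circleAverage_inverse_mul_inverse (ha : ‖a‖ < 1) (hx : ‖x‖ < 1)
    (hax : Commute (a * x) a) :
    circleAverage (fun ζ : ℂ => (1 - ζ⁻¹ • a)⁻¹ʳ * (1 - ζ • x)⁻¹ʳ) 0 1 = (1 - a * x)⁻¹ʳ := by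
  simpa [circleAverage_inverse_one_sub_inv_smul ha] using
    circleAverage_inverse_mul_inverse_mul ha hx hax (differentiableOn_const (1 : R))

theorem inverse_one_sub_inv_smul (ha : ‖a‖ < 1) (hz : ‖z‖ = 1) :
    (1 - z⁻¹ • a)⁻¹ʳ = 1 + z⁻¹ • (a * (1 - z⁻¹ • a)⁻¹ʳ) := by
  have h := Ring.mul_inverse_cancel _
    (isUnit_one_sub_smul ha (z := z⁻¹) (by rw [norm_inv, hz, inv_one]))
  rwa [sub_mul, one_mul, smul_mul_assoc, sub_eq_iff_eq_add] at h

theorem circleAverage_pow_smul_inverse (ha : ‖a‖ < 1) (n : ℕ) :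
    circleAverage (fun ζ : ℂ => ζ ^ n • (1 - ζ⁻¹ • a)⁻¹ʳ) 0 1 = a ^ n := by
  have hA := continuousOn_inverse_one_sub_inv_smul ha
  induction n with
  | zero => simpa using circleAverage_inverse_one_sub_inv_smul ha
  | succ n ih =>
    have shift : Set.EqOn (fun ζ : ℂ => ζ ^ (n + 1) • (1 - ζ⁻¹ • a)⁻¹ʳ)
        (fun ζ => ζ ^ (n + 1) • (1 : R) + a * (ζ ^ n • (1 - ζ⁻¹ • a)⁻¹ʳ)) (sphere 0 |1|) := by
      intro ζ hζ
      have hζ1 : ‖ζ‖ = 1 := by simpa using hζ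
      have hζ0 : ζ ≠ 0 := fun h => by simp [h] at hζ1
      beta_reduce
      conv_lhs => rw [inverse_one_sub_inv_smul ha hζ1]
      rw [smul_add, smul_smul, pow_succ, mul_inv_cancel_right₀ hζ0, mul_smul_comm]
    rw [circleAverage_congr_sphere shift, circleAverage_fun_add
      (ContinuousOn.circleIntegrable zero_le_one (by fun_prop))
      (ContinuousOn.circleIntegrable zero_le_one (by fun_prop)), circleAverage_mul_left _ _
      (ContinuousOn.circleIntegrable zero_le_one (by fun_prop)), ih,
      circleAverage_eq_of_differentiableOn (by fun_prop)]
    simp [pow_succ']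

theorem circleAverage_eval_smul_inverse (ha : ‖a‖ < 1) (p : Polynomial ℂ) :
    circleAverage (fun ζ : ℂ => p.eval ζ • (1 - ζ⁻¹ • a)⁻¹ʳ) 0 1 = Polynomial.aeval a p := by
  have hA := continuousOn_inverse_one_sub_inv_smul ha
  induction p using Polynomial.induction_on' with
  | add p q hp hq =>
    simp only [Polynomial.eval_add, add_smul, map_add]
    rw [circleAverage_fun_add (ContinuousOn.circleIntegrable zero_le_one (by fun_prop))
      (ContinuousOn.circleIntegrable zero_le_one (by fun_prop)), hp, hq]
  | monomial n c =>
    simp only [Polynomial.eval_monomial, Polynomial.aeval_monomial, mul_smul]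
    rw [circleAverage_fun_smul, circleAverage_pow_smul_inverse ha, Algebra.smul_def]

theorem circleAverage_eval_smul_poissonKernel (ha : ‖a‖ < 1) (hx : ‖x‖ < 1) (p : Polynomial ℂ) :
    circleAverage (fun ζ : ℂ => p.eval ζ • ((1 - ζ⁻¹ • a)⁻¹ʳ + (1 - ζ • x)⁻¹ʳ - 1)) 0 1 =
      Polynomial.aeval a p := by
  have hA := continuousOn_inverse_one_sub_inv_smul ha
  have hB := differentiableOn_inverse_one_sub_smul_closedBall hx
  have hBc := continuousOn_inverse_one_sub_smul hx
  have holomorphic_part :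
      circleAverage (fun ζ : ℂ => p.eval ζ • ((1 - ζ • x)⁻¹ʳ - 1)) 0 1 = 0 := by
    rw [circleAverage_eq_of_differentiableOn
      (p.differentiable.differentiableOn.fun_smul (hB.sub_const 1))]
    simp
  simp only [add_sub_assoc, smul_add]
  rw [circleAverage_fun_add (ContinuousOn.circleIntegrable zero_le_one (by fun_prop))
    (ContinuousOn.circleIntegrable zero_le_one (by fun_prop)), holomorphic_part, add_zero,
    circleAverage_eval_smul_inverse ha]

end Resolvent

section PoissonForm

open Metric Real
open scoped Ring

variable {H : Type*} [NormedAddCommGroup H] [InnerProductSpace ℂ H] [CompleteSpace H]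
  {S T T' : H →L[ℂ] H} {c : ℝ}

/-- The Poisson form `x ↦ ⟪x, K x⟫` of `S`, where `K = (1 - S)⁻¹ + (1 - S*)⁻¹ - 1` is the operator
Poisson kernel. It is meant for `‖S‖ < 1`; for other `S` the inverse may take the junk value `0`. -/
noncomputable def poissonForm (S : H →L[ℂ] H) (x : H) : ℝ :=
  2 * (inner ℂ x ((1 - S)⁻¹ʳ x)).re - ‖x‖ ^ 2

/-- `c` times the Poisson form of `z T'` dominates that of `z T`, for every `z` in the open unit
disc. For contractions this is a quadratic-form reading of Harnack domination. -/
def PoissonDominated (c : ℝ) (T T' : H →L[ℂ] H) : Prop :=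
  ∀ z : ℂ, ‖z‖ < 1 → ∀ x, poissonForm (z • T) x ≤ c * poissonForm (z • T') x

theorem norm_smul_lt_one_of_norm_le_one (hT : ‖T‖ ≤ 1) {z : ℂ} (hz : ‖z‖ < 1) : ‖z • T‖ < 1 := by
  rw [norm_smul]
  exact mul_lt_one_of_nonneg_of_lt_one_left (norm_nonneg z) hz hT

theorem one_sub_apply_inverse_one_sub_apply (hS : ‖S‖ < 1) (x : H) :
    (1 - S)⁻¹ʳ x - S ((1 - S)⁻¹ʳ x) = x :=
  DFunLike.congr_fun (Ring.mul_inverse_cancel _ (isUnit_one_sub_of_norm_lt_one hS)) x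

theorem inverse_one_sub_apply_sub_apply (hS : ‖S‖ < 1) (x : H) : (1 - S)⁻¹ʳ (x - S x) = x :=
  DFunLike.congr_fun (Ring.inverse_mul_cancel _ (isUnit_one_sub_of_norm_lt_one hS)) x

theorem poissonForm_sub_apply (hS : ‖S‖ < 1) (y : H) :
    poissonForm S (y - S y) = ‖defectOp S y‖ ^ 2 := by
  rw [poissonForm, inverse_one_sub_apply_sub_apply hS, norm_defectOp_sq hS.le,
    norm_sub_sq (𝕜 := ℂ), inner_sub_left, Complex.sub_re, ← inner_self_eq_norm_sq (𝕜 := ℂ) y,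
    RCLike.re_to_complex, RCLike.re_to_complex, ← Complex.conj_re (inner ℂ (S y) y),
    inner_conj_symm]
  ring

theorem poissonForm_eq_norm_defectOp_sq (hS : ‖S‖ < 1) (x : H) :
    poissonForm S x = ‖defectOp S ((1 - S)⁻¹ʳ x)‖ ^ 2 := by
  rw [← poissonForm_sub_apply hS, one_sub_apply_inverse_one_sub_apply hS]

theorem inverse_one_sub_adjoint (S : H →L[ℂ] H) :
    (1 - adjoint S)⁻¹ʳ = adjoint (1 - S)⁻¹ʳ := by
  rw [← star_eq_adjoint, ← star_eq_adjoint, ← Ring.inverse_star, star_sub, star_one]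

theorem poissonForm_adjoint (S : H →L[ℂ] H) (x : H) :
    poissonForm (adjoint S) x = poissonForm S x := by
  rw [poissonForm, poissonForm, inverse_one_sub_adjoint, adjoint_inner_right, ← inner_conj_symm,
    Complex.conj_re]

theorem ofReal_poissonForm (S : H →L[ℂ] H) (x : H) :
    (poissonForm S x : ℂ) = inner ℂ x (((1 - S)⁻¹ʳ + (1 - adjoint S)⁻¹ʳ - 1) x) := by
  rw [poissonForm, inverse_one_sub_adjoint, sub_apply, add_apply, one_apply_eq_self,
    inner_sub_right, inner_add_right, adjoint_inner_right, inner_self_eq_norm_sq_to_K,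
    ← inner_conj_symm ((1 - S)⁻¹ʳ x), Complex.add_conj]
  push_cast
  rfl

theorem re_inner_realPart (A : H →L[ℂ] H) (x : H) :
    (inner ℂ x ((ℜ A : H →L[ℂ] H) x)).re = (inner ℂ x (A x)).re := by
  have h : (inner ℂ x (star A x)).re = (inner ℂ x (A x)).re := by
    rw [star_eq_adjoint, adjoint_inner_right, ← inner_conj_symm, Complex.conj_re]
  simp only [realPart_apply_coe, smul_apply, add_apply, inner_smul_right_eq_smul, inner_add_right,
    Complex.smul_re, Complex.add_re, h, smul_eq_mul]
  ring

theorem realPart_le_smul_realPart_iff (A B : H →L[ℂ] H) (c : ℝ) :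
    (ℜ A : H →L[ℂ] H) ≤ c • (ℜ B : H →L[ℂ] H) ↔
      ∀ x, (inner ℂ x (A x)).re ≤ c * (inner ℂ x (B x)).re := by
  have hsa : IsSelfAdjoint (c • (ℜ B : H →L[ℂ] H) - (ℜ A : H →L[ℂ] H)) :=
    ((IsSelfAdjoint.all c).smul (ℜ B).2).sub (ℜ A).2
  rw [ContinuousLinearMap.le_def, isPositive_def', and_iff_right hsa]
  refine forall_congr' fun x => ?_
  rw [reApplyInnerSelf_apply, ← re_inner_realPart A, ← re_inner_realPart B, inner_re_symm]
  simp [inner_sub_right, inner_smul_right_eq_smul]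

theorem harnackDominated_iff :
    HarnackDominated T T' ↔ ∃ c : ℝ, 1 ≤ c ∧ ∀ p : Polynomial ℂ,
      (∀ z : ℂ, ‖z‖ ≤ 1 → 0 ≤ (p.eval z).re) → ∀ x,
        (inner ℂ x (Polynomial.aeval T p x)).re ≤ c * (inner ℂ x (Polynomial.aeval T' p x)).re := by
  simp only [HarnackDominated, realPart_le_smul_realPart_iff]

theorem re_one_add_div_one_sub_nonneg {w : ℂ} (hw : ‖w‖ ≤ 1) : 0 ≤ ((1 + w) / (1 - w)).re := by
  have h : w.re * w.re + w.im * w.im ≤ 1 := by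
    rw [← Complex.normSq_apply, Complex.normSq_eq_norm_sq]
    exact pow_le_one₀ (norm_nonneg w) hw
  rw [Complex.div_re, ← add_div]
  refine div_nonneg ?_ (Complex.normSq_nonneg _)
  simp only [Complex.add_re, Complex.sub_re, Complex.add_im, Complex.sub_im, Complex.one_re,
    Complex.one_im]
  linarith

theorem neg_le_re_two_mul_geom_sum_sub_one {r : ℝ} (hr : r < 1) {w : ℂ} (hw : ‖w‖ ≤ r) (N : ℕ) :
    -(2 * (r ^ N / (1 - r))) ≤ (2 * ∑ n ∈ Finset.range N, w ^ n - 1).re := by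
  have hr0 : 0 ≤ r := (norm_nonneg w).trans hw
  have hw1 : w ≠ 1 := by
    rintro rfl
    rw [norm_one] at hw
    linarith
  have tail : ‖w ^ N / (1 - w)‖ ≤ r ^ N / (1 - r) := by
    rw [norm_div, norm_pow]
    have : 0 < 1 - r := sub_pos.mpr hr
    gcongr
    exact (sub_le_sub_left hw 1).trans (by simpa using norm_sub_norm_le (1 : ℂ) w)
  have split : 2 * ∑ n ∈ Finset.range N, w ^ n - 1 =
      (1 + w) / (1 - w) - 2 * (w ^ N / (1 - w)) := by
    have h1 : w - 1 ≠ 0 := sub_ne_zero.mpr hw1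
    have h2 : 1 - w ≠ 0 := sub_ne_zero.mpr hw1.symm
    rw [geom_sum_eq hw1]
    field_simp
    ring
  have hre : (2 * (w ^ N / (1 - w))).re = 2 * (w ^ N / (1 - w)).re := by simp
  rw [split, Complex.sub_re, hre]
  linarith [re_one_add_div_one_sub_nonneg (hw.trans hr.le), Complex.re_le_norm (w ^ N / (1 - w))]

open Filter Topology in
theorem tendsto_re_inner_two_mul_geom_sum_sub_one (hS : ‖S‖ < 1) (x : H) :
    Tendsto (fun N => (inner ℂ x ((2 * ∑ n ∈ Finset.range N, S ^ n - 1) x)).re) atTop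
      (𝓝 (poissonForm S x)) := by
  have tendsto_op : Tendsto (fun N => 2 * ∑ n ∈ Finset.range N, S ^ n - 1) atTop
      (𝓝 (2 * (1 - S)⁻¹ʳ - 1)) := by
    rw [← geom_series_eq_inverse S hS]
    exact ((summable_geometric_of_norm_lt_one hS).hasSum.tendsto_sum_nat.const_mul 2).sub_const 1
  have continuous_form : Continuous fun B : H →L[ℂ] H => (inner ℂ x (B x)).re := by fun_prop
  have form_eq : poissonForm S x = (inner ℂ x ((2 * (1 - S)⁻¹ʳ - 1) x)).re := by
    rw [poissonForm, two_mul, two_mul, sub_apply, add_apply, one_apply_eq_self, inner_sub_right,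
      inner_add_right, Complex.sub_re, Complex.add_re, ← inner_self_eq_norm_sq (𝕜 := ℂ) x,
      RCLike.re_to_complex]
  rw [form_eq]
  exact (continuous_form.tendsto _).comp tendsto_op

open Filter Topology in
/-- Test on the truncations of `(1 + z w) / (1 - z w) = -1 + 2 ∑ (z w) ^ n`, with a small constant
added to restore the sign of the real part. -/
theorem PoissonDominated.of_forall_polynomial (hT : ‖T‖ ≤ 1) (hT' : ‖T'‖ ≤ 1)
    (h : ∀ p : Polynomial ℂ, (∀ z : ℂ, ‖z‖ ≤ 1 → 0 ≤ (p.eval z).re) → ∀ x,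
      (inner ℂ x (Polynomial.aeval T p x)).re ≤ c * (inner ℂ x (Polynomial.aeval T' p x)).re) :
    PoissonDominated c T T' := by
  intro z hz x
  let ε (N : ℕ) : ℝ := 2 * (‖z‖ ^ N / (1 - ‖z‖))
  let p (N : ℕ) : Polynomial ℂ :=
    2 * ∑ n ∈ Finset.range N, (Polynomial.C z * Polynomial.X) ^ n - 1 + Polynomial.C (ε N : ℂ)
  have re_p_nonneg (N : ℕ) (w : ℂ) (hw : ‖w‖ ≤ 1) : 0 ≤ ((p N).eval w).re := by
    have := neg_le_re_two_mul_geom_sum_sub_one hz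
      ((norm_mul_le z w).trans (mul_le_of_le_one_right (norm_nonneg z) hw)) N
    simp only [p, Polynomial.eval_add, Polynomial.eval_sub, Polynomial.eval_mul,
      Polynomial.eval_finsetSum, Polynomial.eval_pow, Polynomial.eval_C, Polynomial.eval_X,
      Polynomial.eval_ofNat, Polynomial.eval_one, Complex.add_re, Complex.ofReal_re]
    linarith
  have re_inner_aeval_p (A : H →L[ℂ] H) (N : ℕ) :
      (inner ℂ x (Polynomial.aeval A (p N) x)).re =
        (inner ℂ x ((2 * ∑ n ∈ Finset.range N, (z • A) ^ n - 1) x)).re + ε N * ‖x‖ ^ 2 := by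
    have aeval_p : Polynomial.aeval A (p N) =
        2 * ∑ n ∈ Finset.range N, (z • A) ^ n - 1 + (ε N : ℂ) • (1 : H →L[ℂ] H) := by
      simp [p, Algebra.algebraMap_eq_smul_one, map_ofNat (Polynomial.aeval A) 2]
    rw [aeval_p, add_apply, inner_add_right, Complex.add_re, smul_apply, one_apply_eq_self,
      inner_smul_right, Complex.re_ofReal_mul, ← inner_self_eq_norm_sq (𝕜 := ℂ) x,
      RCLike.re_to_complex]
  have tendsto_ε : Tendsto (fun N => ε N * ‖x‖ ^ 2) atTop (𝓝 0) := by
    simpa using ((((tendsto_pow_atTop_nhds_zero_of_lt_one (norm_nonneg z) hz).div_const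
      (1 - ‖z‖)).const_mul 2).mul_const (‖x‖ ^ 2))
  have tendsto_form (A : H →L[ℂ] H) (hA : ‖A‖ ≤ 1) :
      Tendsto (fun N => (inner ℂ x (Polynomial.aeval A (p N) x)).re) atTop
        (𝓝 (poissonForm (z • A) x)) := by
    simpa only [re_inner_aeval_p, add_zero] using (tendsto_re_inner_two_mul_geom_sum_sub_one
      (norm_smul_lt_one_of_norm_le_one hA hz) x).add tendsto_ε
  exact le_of_tendsto_of_tendsto' (tendsto_form T hT) ((tendsto_form T' hT').const_mul c)
    fun N => h (p N) (re_p_nonneg N) x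

theorem HarnackDominated.exists_poissonDominated (h : HarnackDominated T T') (hT : ‖T‖ ≤ 1)
    (hT' : ‖T'‖ ≤ 1) : ∃ c, 1 ≤ c ∧ PoissonDominated c T T' := by
  obtain ⟨c, hc, hp⟩ := harnackDominated_iff.mp h
  exact ⟨c, hc, .of_forall_polynomial hT hT' hp⟩

theorem ofReal_poissonForm_inv_smul (S : H →L[ℂ] H) {z : ℂ} (hz : ‖z‖ = 1) (x : H) :
    (poissonForm (z⁻¹ • S) x : ℂ) =
      inner ℂ x (((1 - z⁻¹ • S)⁻¹ʳ + (1 - z • adjoint S)⁻¹ʳ - 1) x) := by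
  rw [ofReal_poissonForm, map_smulₛₗ, Complex.inv_eq_conj hz, Complex.conj_conj]

theorem continuousOn_poissonForm_inv_smul (hS : ‖S‖ < 1) (x : H) :
    ContinuousOn (fun ζ : ℂ => poissonForm (ζ⁻¹ • S) x) (sphere 0 1) := by
  have := continuousOn_inverse_one_sub_inv_smul hS
  unfold poissonForm
  fun_prop

theorem circleAverage_re_inner_apply {f : ℂ → H →L[ℂ] H} (hf : ContinuousOn f (sphere 0 1))
    (u : H) :
    circleAverage (fun ζ => (inner ℂ u (f ζ u)).re) 0 1 =
      (inner ℂ u (circleAverage f 0 1 u)).re :=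
  (Complex.reCLM ∘L (innerSL ℂ u ∘L apply ℂ H u).restrictScalars ℝ).circleAverage_comp_comm
    (hf.circleIntegrable zero_le_one)

theorem circleAverage_re_eval_mul_poissonForm (hS : ‖S‖ < 1) (p : Polynomial ℂ) (x : H) :
    circleAverage (fun ζ : ℂ => (p.eval ζ).re * poissonForm (ζ⁻¹ • S) x) 0 1 =
      (inner ℂ x (Polynomial.aeval S p x)).re := by
  have hS' : ‖adjoint S‖ < 1 := by rwa [LinearIsometryEquiv.norm_map]
  have hA := continuousOn_inverse_one_sub_inv_smul hS
  have hB := continuousOn_inverse_one_sub_smul hS'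
  rw [← circleAverage_eval_smul_poissonKernel hS hS' p,
    ← circleAverage_re_inner_apply (by fun_prop)]
  refine circleAverage_congr_sphere fun ζ hζ => ?_
  have h := ofReal_poissonForm_inv_smul S (show ‖ζ‖ = 1 by simpa using hζ) x
  rw [smul_apply, inner_smul_right, ← h, Complex.re_mul_ofReal]

theorem le_of_continuous_of_forall_lt_one {f g : ℝ → ℝ} (hf : Continuous f) (hg : Continuous g)
    (h : ∀ r, 0 ≤ r → r < 1 → f r ≤ g r) : f 1 ≤ g 1 := by
  have key : Set.Icc (0 : ℝ) 1 ⊆ {r | f r ≤ g r} := by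
    rw [← closure_Ico zero_ne_one]
    exact closure_minimal (fun r hr => h r hr.1 hr.2) (isClosed_le hf hg)
  exact key (Set.right_mem_Icc.mpr zero_le_one)

namespace PoissonDominated

theorem re_inner_aeval_smul_le (h : PoissonDominated c T T') (hT : ‖T‖ ≤ 1) (hT' : ‖T'‖ ≤ 1)
    {p : Polynomial ℂ} (hp : ∀ z : ℂ, ‖z‖ = 1 → 0 ≤ (p.eval z).re) {w : ℂ} (hw : ‖w‖ < 1) (x : H) :
    (inner ℂ x (Polynomial.aeval (w • T) p x)).re ≤
      c * (inner ℂ x (Polynomial.aeval (w • T') p x)).re := by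
  have integrable (A : H →L[ℂ] H) (hA : ‖A‖ ≤ 1) : CircleIntegrable
      (fun ζ : ℂ => (p.eval ζ).re * poissonForm (ζ⁻¹ • w • A) x) 0 1 :=
    have := continuousOn_poissonForm_inv_smul (norm_smul_lt_one_of_norm_le_one hA hw) x
    ContinuousOn.circleIntegrable zero_le_one (by fun_prop)
  rw [← circleAverage_re_eval_mul_poissonForm (norm_smul_lt_one_of_norm_le_one hT hw),
    ← circleAverage_re_eval_mul_poissonForm (norm_smul_lt_one_of_norm_le_one hT' hw), ← smul_eq_mul,
    ← circleAverage_fun_smul]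
  refine circleAverage_mono (integrable T hT) ((integrable T' hT').const_fun_smul) fun ζ hζ => ?_
  have hζ1 : ‖ζ‖ = 1 := by simpa using hζ
  have hform := h (ζ⁻¹ * w) (by simpa [hζ1] using hw) x
  simp only [mul_smul] at hform
  calc (p.eval ζ).re * poissonForm (ζ⁻¹ • w • T) x
      ≤ (p.eval ζ).re * (c * poissonForm (ζ⁻¹ • w • T') x) :=
        mul_le_mul_of_nonneg_left hform (hp ζ hζ1)
    _ = c • ((p.eval ζ).re * poissonForm (ζ⁻¹ • w • T') x) := by rw [smul_eq_mul]; ring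

theorem harnackDominated (h : PoissonDominated c T T') (hc : 1 ≤ c) (hT : ‖T‖ ≤ 1)
    (hT' : ‖T'‖ ≤ 1) : HarnackDominated T T' := by
  refine harnackDominated_iff.mpr ⟨c, hc, fun p hp x => ?_⟩
  have continuous_form (A : H →L[ℂ] H) : Continuous fun r : ℝ =>
      (inner ℂ x (Polynomial.aeval ((r : ℂ) • A) p x)).re := by
    have := (p.continuous_aeval (A := H →L[ℂ] H)).comp
      (Complex.continuous_ofReal.smul (continuous_const (y := A)))
    fun_prop
  have := le_of_continuous_of_forall_lt_one (continuous_form T)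
    ((continuous_form T').const_mul c)
    fun r hr0 hr1 => h.re_inner_aeval_smul_le hT hT' (fun z hz => hp z hz.le)
      (by rwa [Complex.norm_of_nonneg hr0]) x
  simpa using this

end PoissonDominated

end PoissonForm

section HarnackOfShmulyan

open scoped Ring

variable {H : Type*} [NormedAddCommGroup H] [InnerProductSpace ℂ H] [CompleteSpace H]
  {S S' T T' : H →L[ℂ] H}

theorem le_of_sq_le_mul_self {a b : ℝ} (hb : 0 ≤ b) (h : a ^ 2 ≤ b * a) : a ≤ b := by
  by_contra! hlt
  nlinarith

theorem norm_defectOp_adjoint_le_two_mul (hS : ‖S‖ ≤ 1) {f k : H}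
    (h : k - adjoint S k = f - adjoint S (S f)) :
    ‖defectOp (adjoint S) k‖ ≤ 2 * ‖defectOp S f‖ := by
  have adjoint_sub : adjoint S (k - S f) = k - f := by
    rw [map_sub, sub_eq_sub_iff_add_eq_add, add_comm, ← sub_eq_sub_iff_add_eq_add, h]
  have hre : (inner ℂ k f).re - (inner ℂ k (S f)).re = ‖f‖ ^ 2 - ‖S f‖ ^ 2 := by
    have := congrArg (fun v => (inner ℂ v f).re) h
    simpa only [inner_sub_left, adjoint_inner_left, ← RCLike.re_to_complex, map_sub,
      inner_self_eq_norm_sq] using this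
  have norm_defectOp_sub : ‖defectOp (adjoint S) (k - S f)‖ = ‖defectOp S f‖ := by
    rw [← sq_eq_sq₀ (norm_nonneg _) (norm_nonneg _), norm_defectOp_sq (norm_adjoint_le_one hS),
      norm_defectOp_sq hS, adjoint_sub, norm_sub_sq (𝕜 := ℂ), norm_sub_sq (𝕜 := ℂ)]
    simp only [RCLike.re_to_complex]
    linarith
  calc ‖defectOp (adjoint S) k‖
      = ‖defectOp (adjoint S) (k - S f) + defectOp (adjoint S) (S f)‖ := by
        rw [← map_add, sub_add_cancel]
    _ ≤ ‖defectOp S f‖ + ‖defectOp S f‖ :=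
        norm_add_le_of_le norm_defectOp_sub.le (norm_defectOp_adjoint_apply_le hS f)
    _ = 2 * ‖defectOp S f‖ := (two_mul _).symm

theorem norm_defectOp_inverse_one_sub_le (hS : ‖S‖ < 1) {w : H} {M : ℝ} (hM : 0 ≤ M)
    (hw : ∀ y, ‖inner ℂ w y‖ ≤ M * ‖defectOp (adjoint S) y‖) :
    ‖defectOp S ((1 - S)⁻¹ʳ w)‖ ≤ 2 * M := by
  have hS' : ‖adjoint S‖ < 1 := by rwa [LinearIsometryEquiv.norm_map]
  have hf := one_sub_apply_inverse_one_sub_apply hS w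
  set f := (1 - S)⁻¹ʳ w
  have hk := one_sub_apply_inverse_one_sub_apply hS' (f - adjoint S (S f))
  set k := (1 - adjoint S)⁻¹ʳ (f - adjoint S (S f))
  have norm_sq_eq : ‖defectOp S f‖ ^ 2 = (inner ℂ w k).re := by
    rw [← inner_self_eq_norm_sq (𝕜 := ℂ), inner_defectOp_left, defectOp_defectOp_apply hS.le, ← hk,
      inner_sub_right, adjoint_inner_right, ← inner_sub_left, hf, RCLike.re_to_complex]
  have norm_sq_le : ‖defectOp S f‖ ^ 2 ≤ 2 * M * ‖defectOp S f‖ :=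
    calc ‖defectOp S f‖ ^ 2 ≤ M * ‖defectOp (adjoint S) k‖ :=
          norm_sq_eq.trans_le ((Complex.re_le_norm _).trans (hw k))
      _ ≤ M * (2 * ‖defectOp S f‖) := by
          gcongr
          exact norm_defectOp_adjoint_le_two_mul hS.le hk
      _ = 2 * M * ‖defectOp S f‖ := by ring
  exact le_of_sq_le_mul_self (by positivity) norm_sq_le

theorem poissonForm_le_of_norm_inner_le (hS : ‖S‖ < 1) (hS' : ‖S'‖ < 1) {C K : ℝ} (hC : 0 ≤ C)
    (hK : ∀ x, ‖defectOp S' x‖ ≤ K * ‖defectOp S x‖)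
    (h : ∀ x y, ‖inner ℂ ((S' - S) x) y‖ ≤ C * ‖defectOp S x‖ * ‖defectOp (adjoint S') y‖)
    (u : H) : poissonForm S' u ≤ (K + 2 * C) ^ 2 * poissonForm S u := by
  have hu := one_sub_apply_inverse_one_sub_apply hS u
  rw [poissonForm_eq_norm_defectOp_sq hS, poissonForm_eq_norm_defectOp_sq hS', ← mul_pow]
  set x := (1 - S)⁻¹ʳ u
  have resolvent_identity : (1 - S')⁻¹ʳ u = x + (1 - S')⁻¹ʳ ((S' - S) x) := by
    have hu' : u = (x - S' x) + (S' - S) x := by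
      rw [← hu, sub_apply]
      abel
    conv_lhs => rw [hu', map_add, inverse_one_sub_apply_sub_apply hS']
  gcongr
  calc ‖defectOp S' ((1 - S')⁻¹ʳ u)‖
      = ‖defectOp S' x + defectOp S' ((1 - S')⁻¹ʳ ((S' - S) x))‖ := by
        rw [resolvent_identity, map_add]
    _ ≤ K * ‖defectOp S x‖ + 2 * (C * ‖defectOp S x‖) :=
        norm_add_le_of_le (hK x) (norm_defectOp_inverse_one_sub_le hS' (by positivity) (h x))
    _ = (K + 2 * C) * ‖defectOp S x‖ := by ring

theorem norm_defectOp_smul_sq (hT : ‖T‖ ≤ 1) {z : ℂ} (hz : ‖z‖ < 1) (x : H) :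
    ‖defectOp (z • T) x‖ ^ 2 = (1 - ‖z‖ ^ 2) * ‖x‖ ^ 2 + ‖z‖ ^ 2 * ‖defectOp T x‖ ^ 2 := by
  rw [norm_defectOp_sq (norm_smul_lt_one_of_norm_le_one hT hz).le, norm_defectOp_sq hT, smul_apply,
    norm_smul]
  ring

theorem norm_defectOp_le_norm_defectOp_smul (hT : ‖T‖ ≤ 1) {z : ℂ} (hz : ‖z‖ < 1) (x : H) :
    ‖defectOp T x‖ ≤ ‖defectOp (z • T) x‖ := by
  refine le_of_sq_le_sq ?_ (norm_nonneg _)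
  rw [norm_defectOp_sq (norm_smul_lt_one_of_norm_le_one hT hz).le, norm_defectOp_sq hT, smul_apply,
    norm_smul]
  gcongr
  exact mul_le_of_le_one_left (norm_nonneg _) hz.le

theorem norm_defectOp_smul_le (hT : ‖T‖ ≤ 1) (hT' : ‖T'‖ ≤ 1) {K : ℝ} (hK1 : 1 ≤ K)
    (hK : ∀ x, ‖defectOp T' x‖ ≤ K * ‖defectOp T x‖) {z : ℂ} (hz : ‖z‖ < 1) (x : H) :
    ‖defectOp (z • T') x‖ ≤ K * ‖defectOp (z • T) x‖ := by
  refine le_of_sq_le_sq ?_ (by positivity)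
  have hz2 : 0 ≤ 1 - ‖z‖ ^ 2 := sub_nonneg.mpr (pow_le_one₀ (norm_nonneg z) hz.le)
  rw [mul_pow, norm_defectOp_smul_sq hT' hz, norm_defectOp_smul_sq hT hz]
  calc (1 - ‖z‖ ^ 2) * ‖x‖ ^ 2 + ‖z‖ ^ 2 * ‖defectOp T' x‖ ^ 2
      ≤ K ^ 2 * ((1 - ‖z‖ ^ 2) * ‖x‖ ^ 2) + ‖z‖ ^ 2 * (K * ‖defectOp T x‖) ^ 2 := by
        refine add_le_add (le_mul_of_one_le_left (by positivity) (one_le_pow₀ hK1)) ?_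
        gcongr
        exact hK x
    _ = K ^ 2 * ((1 - ‖z‖ ^ 2) * ‖x‖ ^ 2 + ‖z‖ ^ 2 * ‖defectOp T x‖ ^ 2) := by ring

theorem poissonDominated_of_norm_inner_le (hT : ‖T‖ ≤ 1) (hT' : ‖T'‖ ≤ 1) {C K : ℝ} (hC : 0 ≤ C)
    (hK1 : 1 ≤ K) (hK : ∀ x, ‖defectOp T' x‖ ≤ K * ‖defectOp T x‖)
    (h : ∀ x y, ‖inner ℂ ((T' - T) x) y‖ ≤ C * ‖defectOp T x‖ * ‖defectOp (adjoint T') y‖) :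
    PoissonDominated ((K + 2 * C) ^ 2) T' T := fun z hz =>
  poissonForm_le_of_norm_inner_le (norm_smul_lt_one_of_norm_le_one hT hz)
    (norm_smul_lt_one_of_norm_le_one hT' hz) hC (norm_defectOp_smul_le hT hT' hK1 hK hz)
    fun x y => by
      rw [← smul_sub, smul_apply, inner_smul_left, norm_mul, RCLike.norm_conj, map_smulₛₗ]
      refine (mul_le_of_le_one_left (norm_nonneg _) hz.le).trans ((h x y).trans ?_)
      gcongr
      · exact norm_defectOp_le_norm_defectOp_smul hT hz x
      · exact norm_defectOp_le_norm_defectOp_smul (norm_adjoint_le_one hT')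
          (by rwa [RCLike.norm_conj]) y

namespace ShmulyanEquivalent

theorem harnackDominated (h : ShmulyanEquivalent T T') (hT : ‖T‖ ≤ 1) (hT' : ‖T'‖ ≤ 1) :
    HarnackDominated T' T := by
  obtain ⟨C, hC, hTT'⟩ := h.2.exists_norm_inner_le
  obtain ⟨K, hK1, hK⟩ := h.2.exists_norm_defectOp_le hT hT'
  obtain ⟨L, hL1, hL⟩ := (h.1.adjoint hT').exists_norm_defectOp_le (norm_adjoint_le_one hT')
    (norm_adjoint_le_one hT)
  have mixed (x y : H) :
      ‖inner ℂ ((T' - T) x) y‖ ≤ C * L * ‖defectOp T x‖ * ‖defectOp (adjoint T') y‖ :=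
    calc ‖inner ℂ ((T' - T) x) y‖ ≤ C * ‖defectOp T x‖ * ‖defectOp (adjoint T) y‖ := hTT' x y
      _ ≤ C * ‖defectOp T x‖ * (L * ‖defectOp (adjoint T') y‖) := by
        gcongr
        exact hL y
      _ = C * L * ‖defectOp T x‖ * ‖defectOp (adjoint T') y‖ := by ring
  have hCL : 0 ≤ C * L := by positivity
  exact (poissonDominated_of_norm_inner_le hT hT' hCL hK1 hK mixed).harnackDominated
    (one_le_pow₀ (by linarith)) hT' hT

theorem harnackEquivalent (h : ShmulyanEquivalent T T') (hT : ‖T‖ ≤ 1) (hT' : ‖T'‖ ≤ 1) :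
    HarnackEquivalent T T' :=
  ⟨harnackDominated h.symm hT' hT, h.harnackDominated hT hT'⟩

end ShmulyanEquivalent

end HarnackOfShmulyan

section CircleComparison

open Metric Real
open scoped Ring

variable {H : Type*} [NormedAddCommGroup H] [InnerProductSpace ℂ H] [CompleteSpace H]
  {S S' T T' X : H →L[ℂ] H} {c : ℝ}

theorem defectOp_smul_of_norm_eq_one (S : H →L[ℂ] H) {z : ℂ} (hz : ‖z‖ = 1) :
    defectOp (z • S) = defectOp S := by
  rw [defectOp, map_smulₛₗ, smul_comp, comp_smul, smul_smul, Complex.conj_mul', hz, defectOp]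
  simp

theorem norm_defectOp_sq_le_of_forall_poissonForm_le (hS : ‖S‖ < 1) (hS' : ‖S'‖ < 1) (hc : 0 ≤ c)
    (h : ∀ ζ : ℂ, ‖ζ‖ = 1 → ∀ x, poissonForm (ζ • S) x ≤ c * poissonForm (ζ • S') x) (y : H) :
    ‖defectOp S y‖ ^ 2 ≤ c * ‖defectOp S' y‖ ^ 2 := by
  let F (ζ : ℂ) : H := defectOp S ((1 - ζ • S)⁻¹ʳ (y - ζ • S' y))
  have differentiableOn_F : DifferentiableOn ℂ F (closedBall 0 1) := by
    have := differentiableOn_inverse_one_sub_smul_closedBall hS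
    fun_prop
  have norm_F_le (ζ : ℂ) (hζ : ζ ∈ frontier (ball (0 : ℂ) 1)) :
      ‖F ζ‖ ≤ √(c * ‖defectOp S' y‖ ^ 2) := by
    have hζ1 : ‖ζ‖ = 1 := by rwa [frontier_ball _ one_ne_zero, mem_sphere_zero_iff_norm] at hζ
    refine Real.le_sqrt_of_sq_le ?_
    calc ‖F ζ‖ ^ 2 = poissonForm (ζ • S) (y - (ζ • S') y) := by
          rw [poissonForm_eq_norm_defectOp_sq (norm_smul_lt_one hS hζ1.le),
            defectOp_smul_of_norm_eq_one S hζ1, smul_apply]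
      _ ≤ c * poissonForm (ζ • S') (y - (ζ • S') y) := h ζ hζ1 _
      _ = c * ‖defectOp S' y‖ ^ 2 := by
          rw [poissonForm_sub_apply (norm_smul_lt_one hS' hζ1.le),
            defectOp_smul_of_norm_eq_one S' hζ1]
  have norm_F_zero_le : ‖F 0‖ ≤ √(c * ‖defectOp S' y‖ ^ 2) :=
    Complex.norm_le_of_forall_mem_frontier_norm_le isBounded_ball
      (differentiableOn_F.mono closure_ball_subset_closedBall).diffContOnCl norm_F_le
      (subset_closure (mem_ball_self one_pos))
  have F_zero : F 0 = defectOp S y := by simp [F]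
  rw [← F_zero]
  exact (Real.le_sqrt (norm_nonneg _) (by positivity)).mp norm_F_zero_le

theorem inner_inverse_one_sub_smul_apply (S : H →L[ℂ] H) {ζ : ℂ} (hζ : ‖ζ‖ = 1) (B : H →L[ℂ] H)
    (u : H) :
    inner ℂ ((1 - ζ • S)⁻¹ʳ u) (B ((1 - ζ • S)⁻¹ʳ u)) =
      inner ℂ u (((1 - ζ⁻¹ • adjoint S)⁻¹ʳ * (B * (1 - ζ • S)⁻¹ʳ)) u) := by
  rw [Complex.inv_eq_conj hζ, ← map_smulₛₗ, inverse_one_sub_adjoint, mul_apply_eq_comp,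
    adjoint_inner_right, mul_apply_eq_comp]

theorem circleAverage_poissonForm_inverse (hS : ‖S‖ < 1) (hX : ‖X‖ < 1)
    (hSS : Commute (adjoint S * S) (adjoint S)) (hSX : Commute (adjoint S * X) (adjoint S))
    (u : H) :
    circleAverage (fun ζ : ℂ => poissonForm (ζ • X) ((1 - ζ • S)⁻¹ʳ u)) 0 1 =
      2 * (inner ℂ u (((1 - adjoint S * X)⁻¹ʳ * (1 - adjoint S * S)⁻¹ʳ) u)).re -
        (inner ℂ u ((1 - adjoint S * S)⁻¹ʳ u)).re := by
  have hS' : ‖adjoint S‖ < 1 := by rwa [LinearIsometryEquiv.norm_map]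
  have hA := continuousOn_inverse_one_sub_inv_smul hS'
  have hR := differentiableOn_inverse_one_sub_smul_closedBall hS
  have hRc := continuousOn_inverse_one_sub_smul hS
  have hXc := continuousOn_inverse_one_sub_smul hX
  let f (ζ : ℂ) : H →L[ℂ] H :=
    (1 - ζ⁻¹ • adjoint S)⁻¹ʳ * ((1 - ζ • X)⁻¹ʳ * (1 - ζ • S)⁻¹ʳ)
  let g (ζ : ℂ) : H →L[ℂ] H := (1 - ζ⁻¹ • adjoint S)⁻¹ʳ * (1 - ζ • S)⁻¹ʳ
  have hf : ContinuousOn f (sphere 0 1) := hA.fun_mul (hXc.fun_mul hRc)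
  have hg : ContinuousOn g (sphere 0 1) := hA.fun_mul hRc
  have form_eq : Set.EqOn (fun ζ : ℂ => poissonForm (ζ • X) ((1 - ζ • S)⁻¹ʳ u))
      (fun ζ => (2 : ℝ) • (inner ℂ u (f ζ u)).re - (inner ℂ u (g ζ u)).re) (sphere 0 |1|) := by
    intro ζ hζ
    have hζ1 : ‖ζ‖ = 1 := by simpa using hζ
    have norm_sq := inner_inverse_one_sub_smul_apply S hζ1 1 u
    rw [one_mul, one_apply_eq_self] at norm_sq
    simp only [poissonForm, f, g, smul_eq_mul]
    rw [inner_inverse_one_sub_smul_apply S hζ1, ← norm_sq, ← inner_self_eq_norm_sq (𝕜 := ℂ),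
      RCLike.re_to_complex]
  rw [circleAverage_congr_sphere form_eq, circleAverage_fun_sub
    (ContinuousOn.circleIntegrable zero_le_one (by fun_prop))
    (ContinuousOn.circleIntegrable zero_le_one (by fun_prop)), circleAverage_fun_smul,
    circleAverage_re_inner_apply hf, circleAverage_re_inner_apply hg,
    circleAverage_inverse_mul_inverse_mul hS' hX hSX hR,
    circleAverage_inverse_mul_inverse hS' hS hSS, smul_eq_mul]

theorem norm_adjoint_mul_lt_one (hS : ‖S‖ < 1) (hX : ‖X‖ < 1) : ‖adjoint S * X‖ < 1 := by
  refine (norm_mul_le _ _).trans_lt ?_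
  rw [LinearIsometryEquiv.norm_map]
  exact mul_lt_one_of_nonneg_of_lt_one_left (norm_nonneg S) hS hX.le

theorem one_sub_adjoint_mul_self_inner_left (S : H →L[ℂ] H) (x y : H) :
    inner ℂ ((1 - adjoint S * S) x) y = inner ℂ x ((1 - adjoint S * S) y) := by
  simp only [sub_apply, mul_apply_eq_comp, one_apply_eq_self, inner_sub_left, inner_sub_right,
    adjoint_inner_left, adjoint_inner_right]

theorem circleAverage_poissonForm_inverse_one_sub_apply (hS : ‖S‖ < 1) (hX : ‖X‖ < 1)
    (hSS : Commute (adjoint S * S) (adjoint S)) (hSX : Commute (adjoint S * X) (adjoint S))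
    {v x : H} (hv : v = (1 - adjoint S * X) x) :
    circleAverage (fun ζ : ℂ =>
        poissonForm (ζ • X) ((1 - ζ • S)⁻¹ʳ ((1 - adjoint S * S) v))) 0 1 =
      (inner ℂ v ((1 - adjoint S * S) ((1 + adjoint S * X) x))).re := by
  have hQv : (1 - adjoint S * S)⁻¹ʳ ((1 - adjoint S * S) v) = v :=
    inverse_one_sub_apply_sub_apply (norm_adjoint_mul_lt_one hS hS) v
  have hWx : (1 - adjoint S * X)⁻¹ʳ v = x := by
    rw [hv]
    exact inverse_one_sub_apply_sub_apply (norm_adjoint_mul_lt_one hS hX) x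
  have two_mul_sub : (1 + adjoint S * X) x = x + x - v := by
    rw [hv, sub_apply, add_apply, one_apply_eq_self]
    abel
  rw [circleAverage_poissonForm_inverse hS hX hSS hSX, mul_apply_eq_comp, hQv, hWx,
    ← one_sub_adjoint_mul_self_inner_left S v ((1 + adjoint S * X) x), two_mul_sub, inner_sub_right,
    inner_add_right, Complex.sub_re, Complex.add_re, two_mul]

theorem norm_sq_le_circleAverage_poissonForm (hS : ‖S‖ < 1)
    (hSS : Commute (adjoint S * S) (adjoint S)) (v : H) :
    ‖v‖ ^ 2 ≤ circleAverage (fun ζ : ℂ =>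
      poissonForm (ζ • S) ((1 - ζ • S)⁻¹ʳ ((1 - adjoint S * S) v))) 0 1 := by
  obtain ⟨x, hv⟩ : ∃ x, v = (1 - adjoint S * S) x :=
    ⟨_, (one_sub_apply_inverse_one_sub_apply (norm_adjoint_mul_lt_one hS hS) v).symm⟩
  have hcomm : (1 - adjoint S * S) ((1 + adjoint S * S) x) = v + (adjoint S * S) v := by
    simp only [hv, sub_apply, add_apply, one_apply_eq_self, map_sub, map_add]
  rw [circleAverage_poissonForm_inverse_one_sub_apply hS hS hSS hSS hv, hcomm, inner_add_right,
    mul_apply_eq_comp, adjoint_inner_right, Complex.add_re, ← RCLike.re_to_complex,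
    ← RCLike.re_to_complex, inner_self_eq_norm_sq, inner_self_eq_norm_sq]
  exact le_add_of_nonneg_right (sq_nonneg _)

theorem circleIntegrable_poissonForm_inverse (hS : ‖S‖ < 1) (hX : ‖X‖ < 1) (u : H) :
    CircleIntegrable (fun ζ : ℂ => poissonForm (ζ • X) ((1 - ζ • S)⁻¹ʳ u)) 0 1 := by
  have hRS := continuousOn_inverse_one_sub_smul hS
  have hRX := continuousOn_inverse_one_sub_smul hX
  refine ContinuousOn.circleIntegrable zero_le_one ?_
  unfold poissonForm
  fun_prop

theorem norm_one_sub_adjoint_mul_apply_le (hS : ‖S‖ < 1) (hS' : ‖S'‖ < 1) (hc : 0 ≤ c)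
    (hSS : Commute (adjoint S * S) (adjoint S)) (hSS' : Commute (adjoint S * S') (adjoint S))
    (hQW : Commute (adjoint S * S) (adjoint S * S'))
    (h : ∀ ζ : ℂ, ‖ζ‖ = 1 → ∀ x, poissonForm (ζ • S) x ≤ c * poissonForm (ζ • S') x) (x : H) :
    ‖(1 - adjoint S * S') x‖ ≤ 2 * c * ‖(1 - adjoint S * S) x‖ := by
  set W := adjoint S * S'
  set Q := adjoint S * S
  set v := (1 - W) x with hv
  have average_le := circleAverage_mono
    (f₁ := fun ζ : ℂ => poissonForm (ζ • S) ((1 - ζ • S)⁻¹ʳ ((1 - Q) v)))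
    (f₂ := fun ζ : ℂ => c • poissonForm (ζ • S') ((1 - ζ • S)⁻¹ʳ ((1 - Q) v)))
    (c := 0) (R := 1) (circleIntegrable_poissonForm_inverse hS hS _)
    (circleIntegrable_poissonForm_inverse hS hS' _).const_fun_smul
    (fun ζ hζ => h ζ (by simpa using hζ) _)
  rw [circleAverage_fun_smul, circleAverage_poissonForm_inverse_one_sub_apply hS hS' hSS hSS' hv,
    smul_eq_mul] at average_le
  have hcomm : (1 - Q) ((1 + W) x) = (1 + W) ((1 - Q) x) :=
    DFunLike.congr_fun (((Commute.one_right _).add_right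
      ((Commute.one_left W).sub_left hQW)).eq : (1 - Q) * (1 + W) = (1 + W) * (1 - Q)) x
  have norm_le : ‖(1 + W) ((1 - Q) x)‖ ≤ 2 * ‖(1 - Q) x‖ := by
    rw [add_apply, one_apply_eq_self, two_mul]
    exact norm_add_le_of_le le_rfl
      ((W.le_of_opNorm_le (norm_adjoint_mul_lt_one hS hS').le _).trans_eq (one_mul _))
  refine le_of_sq_le_mul_self (by positivity) ?_
  calc ‖v‖ ^ 2 ≤ c * (inner ℂ v ((1 + W) ((1 - Q) x))).re := by
        rw [← hcomm]
        exact (norm_sq_le_circleAverage_poissonForm hS hSS v).trans average_le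
    _ ≤ c * (‖v‖ * (2 * ‖(1 - Q) x‖)) := by
        gcongr
        exact (Complex.re_le_norm _).trans ((norm_inner_le_norm _ _).trans (by gcongr))
    _ = 2 * c * ‖(1 - Q) x‖ * ‖v‖ := by ring

end CircleComparison

section ShmulyanOfHarnack

variable {H : Type*} [NormedAddCommGroup H] [InnerProductSpace ℂ H] [CompleteSpace H]
  {T T' : H →L[ℂ] H} {c : ℝ}

theorem adjoint_ofReal_smul (r : ℝ) (T : H →L[ℂ] H) :
    adjoint ((r : ℂ) • T) = (r : ℂ) • adjoint T := by
  rw [map_smulₛₗ, Complex.conj_ofReal]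

theorem norm_inner_le_of_commute_of_norm_le {A D : H →L[ℂ] H} (hD : IsSelfAdjoint D)
    (hAD : Commute A D) {M : ℝ} (hA : ∀ x, ‖A x‖ ≤ M * ‖D (D x)‖) (x y : H) :
    ‖inner ℂ (A x) y‖ ≤ M * ‖D x‖ * ‖D y‖ := by
  let K : Submodule ℂ H := D.range.topologicalClosure
  have : CompleteSpace K := (Submodule.isClosed_topologicalClosure _).completeSpace_coe
  have on_K (v : H) (hv : v ∈ K) : ‖inner ℂ (A v) y‖ ≤ M * ‖D v‖ * ‖D y‖ := by
    refine closure_minimal (t := {v | ‖inner ℂ (A v) y‖ ≤ M * ‖D v‖ * ‖D y‖}) ?_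
      (isClosed_le (by fun_prop) (by fun_prop)) hv
    rintro - ⟨g, rfl⟩
    have hADg : A (D g) = D (A g) := DFunLike.congr_fun hAD.eq g
    calc ‖inner ℂ (A (D g)) y‖ = ‖inner ℂ (A g) (D y)‖ := by
          rw [hADg]
          exact congrArg _ (hD.isSymmetric (A g) y)
      _ ≤ ‖A g‖ * ‖D y‖ := norm_inner_le_norm _ _
      _ ≤ M * ‖D (D g)‖ * ‖D y‖ := by
          gcongr
          exact hA g
  obtain ⟨v, hv, k, hk, rfl⟩ := K.exists_add_mem_mem_orthogonal x
  have hDk : D k = 0 := by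
    rwa [Submodule.orthogonal_closure, ContinuousLinearMap.orthogonal_range, hD.adjoint_eq] at hk
  have hAk : A k = 0 := by simpa [hDk] using hA k
  simpa [hDk, hAk] using on_K v hv

namespace IsQuasiNormal

theorem commute_adjoint_mul_self (hT : IsQuasiNormal T) : Commute (adjoint T * T) (adjoint T) := by
  have := hT.star_star
  rw [star_mul, ← star_eq_adjoint, star_star] at this
  exact this.symm

end IsQuasiNormal

namespace DoublyCommute

theorem of_commute (hT : IsStarNormal T) (h : Commute T T') : DoublyCommute T T' := by
  refine ⟨h, ?_⟩
  have := (hT.commute_star_left h).star_star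
  rwa [star_star] at this

theorem commute_adjoint_left (h : DoublyCommute T T') : Commute (adjoint T) T' := by
  have := h.2.star_star
  rwa [star_eq_adjoint, star_eq_adjoint, adjoint_adjoint] at this

theorem commute_adjoint_mul (h : DoublyCommute T T') : Commute (adjoint T * T') (adjoint T) :=
  (Commute.refl _).mul_left h.commute_adjoint_left.symm

theorem commute_adjoint_mul_self (h : DoublyCommute T T') (hT : IsQuasiNormal T) :
    Commute (adjoint T * T) (adjoint T * T') :=
  hT.commute_adjoint_mul_self.mul_right (h.commute_adjoint_left.mul_left h.1)

end DoublyCommute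

theorem sub_apply_eq_defectOp_sub (hT : ‖T‖ ≤ 1) (T' : H →L[ℂ] H) (x : H) :
    (T' - T) x = defectOp (adjoint T) (defectOp (adjoint T) (T' x)) -
      T ((1 - adjoint T * T') x) := by
  rw [defectOp_defectOp_apply (norm_adjoint_le_one hT), adjoint_adjoint]
  simp only [sub_apply, one_apply_eq_self, mul_apply_eq_comp, map_sub]
  abel

theorem norm_adjoint_mul_le_one (hT : ‖T‖ ≤ 1) (hT' : ‖T'‖ ≤ 1) : ‖adjoint T * T'‖ ≤ 1 :=
  (norm_mul_le _ _).trans (mul_le_one₀ (norm_adjoint_le_one hT) (norm_nonneg _) hT')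

namespace PoissonDominated

protected theorem adjoint (h : PoissonDominated c T T') :
    PoissonDominated c (adjoint T) (adjoint T') := fun z hz x => by
  have := h (starRingEnd ℂ z) (by rwa [RCLike.norm_conj]) x
  rwa [← poissonForm_adjoint, ← poissonForm_adjoint (_ • T'), map_smulₛₗ, map_smulₛₗ,
    Complex.conj_conj] at this

omit [CompleteSpace H] in
theorem poissonForm_smul_smul_le (h : PoissonDominated c T T') {w : ℂ} (hw : ‖w‖ < 1)
    {ζ : ℂ} (hζ : ‖ζ‖ = 1) (x : H) :
    poissonForm (ζ • w • T) x ≤ c * poissonForm (ζ • w • T') x := by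
  simpa only [mul_smul] using h (ζ * w) (by simpa [hζ] using hw) x

theorem norm_defectOp_sq_le (h : PoissonDominated c T T') (hT : ‖T‖ ≤ 1) (hT' : ‖T'‖ ≤ 1)
    (hc : 0 ≤ c) (x : H) : ‖defectOp T x‖ ^ 2 ≤ c * ‖defectOp T' x‖ ^ 2 := by
  rw [norm_defectOp_sq hT, norm_defectOp_sq hT']
  have := le_of_continuous_of_forall_lt_one (f := fun r : ℝ => ‖x‖ ^ 2 - ‖((r : ℂ) • T) x‖ ^ 2)
    (g := fun r : ℝ => c * (‖x‖ ^ 2 - ‖((r : ℂ) • T') x‖ ^ 2))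
    (by simp only [smul_apply]; fun_prop) (by simp only [smul_apply]; fun_prop)
    fun r hr0 hr1 => by
      have hr : ‖(r : ℂ)‖ < 1 := by rwa [Complex.norm_of_nonneg hr0]
      have hS := norm_smul_lt_one_of_norm_le_one hT hr
      have hS' := norm_smul_lt_one_of_norm_le_one hT' hr
      rw [← norm_defectOp_sq hS.le, ← norm_defectOp_sq hS'.le]
      exact norm_defectOp_sq_le_of_forall_poissonForm_le hS hS' hc
        (fun ζ hζ => h.poissonForm_smul_smul_le hr hζ) x
  simpa using this

theorem norm_defectOp_le (h : PoissonDominated c T T') (hT : ‖T‖ ≤ 1) (hT' : ‖T'‖ ≤ 1)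
    (hc : 1 ≤ c) (x : H) : ‖defectOp T x‖ ≤ c * ‖defectOp T' x‖ := by
  refine le_of_sq_le_sq ((h.norm_defectOp_sq_le hT hT' (by linarith) x).trans ?_) (by positivity)
  rw [mul_pow]
  gcongr
  exact le_self_pow₀ hc two_ne_zero

protected theorem norm_one_sub_adjoint_mul_apply_le (h : PoissonDominated c T T') (hT : ‖T‖ ≤ 1)
    (hT' : ‖T'‖ ≤ 1) (hc : 0 ≤ c) (hTT' : DoublyCommute T T') (hqT : IsQuasiNormal T) (x : H) :
    ‖(1 - adjoint T * T') x‖ ≤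
      2 * c * ‖(1 - adjoint T * T) x‖ := by
  have continuous_norm (A : H →L[ℂ] H) : Continuous fun r : ℝ =>
      ‖(1 - adjoint ((r : ℂ) • T) * ((r : ℂ) • A)) x‖ := by
    simp only [adjoint_ofReal_smul]
    fun_prop
  have := le_of_continuous_of_forall_lt_one (continuous_norm T')
    ((continuous_norm T).const_mul (2 * c)) fun r hr0 hr1 => by
      have hr : ‖(r : ℂ)‖ < 1 := by rwa [Complex.norm_of_nonneg hr0]
      refine norm_one_sub_adjoint_mul_apply_le (norm_smul_lt_one_of_norm_le_one hT hr)
        (norm_smul_lt_one_of_norm_le_one hT' hr) hc ?_ ?_ ?_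
        (fun ζ hζ => h.poissonForm_smul_smul_le hr hζ) x
      all_goals simp only [adjoint_ofReal_smul, smul_mul_assoc, mul_smul_comm]
      · exact (((hqT.commute_adjoint_mul_self.smul_left _).smul_left _).smul_right _)
      · exact (((hTT'.commute_adjoint_mul.smul_left _).smul_left _).smul_right _)
      · exact ((((hTT'.commute_adjoint_mul_self hqT).smul_left _).smul_left _).smul_right
          _).smul_right _
  simpa using this

theorem norm_inner_one_sub_adjoint_mul_le (h : PoissonDominated c T T') (hT : ‖T‖ ≤ 1)
    (hT' : ‖T'‖ ≤ 1) (hc : 0 ≤ c) (hTT' : DoublyCommute T T') (hqT : IsQuasiNormal T) (x y : H) :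
    ‖inner ℂ ((1 - adjoint T * T') x) y‖ ≤
      2 * c * ‖defectOp T x‖ * ‖defectOp T y‖ := by
  refine norm_inner_le_of_commute_of_norm_le (isSelfAdjoint_defectOp T) (commute_defectOp ?_)
    (fun g => ?_) x y
  · exact (Commute.one_left _).sub_left (hTT'.commute_adjoint_mul_self hqT).symm
  · rw [defectOp_defectOp_apply hT]
    exact h.norm_one_sub_adjoint_mul_apply_le hT hT' hc hTT' hqT g

protected theorem norm_defectOp_adjoint_apply_le (h : PoissonDominated c T T') (hT : ‖T‖ ≤ 1)
    (hT' : ‖T'‖ ≤ 1) (hc : 1 ≤ c) (hTT' : DoublyCommute T T') (hqT : IsQuasiNormal T) (x : H) :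
    ‖defectOp (adjoint T) (T' x)‖ ≤ 2 * c * ‖defectOp T x‖ := by
  have key := h.norm_inner_one_sub_adjoint_mul_le hT hT' (by linarith) hTT' hqT x
  have hDW : Commute (adjoint T * T') (defectOp T) :=
    commute_defectOp (hTT'.commute_adjoint_mul_self hqT).symm
  have hW := norm_adjoint_mul_le_one hT hT'
  have hTW : adjoint T (T' x) = (adjoint T * T') x := rfl
  set W := adjoint T * T'
  have hDWx : defectOp T (W x) = W (defectOp T x) := (DFunLike.congr_fun hDW.eq x).symm
  have norm_defectOp_add_le : ‖defectOp T (x + W x)‖ ≤ 2 * ‖defectOp T x‖ := by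
    rw [map_add, hDWx, two_mul]
    exact norm_add_le_of_le le_rfl ((W.le_of_opNorm_le hW _).trans_eq (one_mul _))
  refine le_of_sq_le_sq ?_ (by positivity)
  calc ‖defectOp (adjoint T) (T' x)‖ ^ 2
      = ‖T' x‖ ^ 2 - ‖W x‖ ^ 2 := by rw [norm_defectOp_sq (norm_adjoint_le_one hT), hTW]
    _ ≤ ‖x‖ ^ 2 - ‖W x‖ ^ 2 := by
        gcongr
        exact (T'.le_of_opNorm_le hT' x).trans_eq (one_mul _)
    _ = (inner ℂ ((1 - W) x) (x + W x)).re := by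
        rw [sub_apply, one_apply_eq_self, ← RCLike.re_to_complex, inner_sub_left, inner_add_right,
          inner_add_right, map_sub, map_add, map_add, inner_self_eq_norm_sq, inner_self_eq_norm_sq,
          inner_re_symm (W x) x]
        ring
    _ ≤ 2 * c * ‖defectOp T x‖ * ‖defectOp T (x + W x)‖ :=
        (Complex.re_le_norm _).trans (key (x + W x))
    _ ≤ 2 * c * ‖defectOp T x‖ * (2 * c * ‖defectOp T x‖) := by
        gcongr
        exact norm_defectOp_add_le.trans (by gcongr; linarith)
    _ = (2 * c * ‖defectOp T x‖) ^ 2 := (sq _).symm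

theorem norm_inner_sub_le (h : PoissonDominated c T T') (hT : ‖T‖ ≤ 1) (hT' : ‖T'‖ ≤ 1)
    (hc : 1 ≤ c) (hTT' : DoublyCommute T T') (hqT : IsQuasiNormal T) (x y : H) :
    ‖inner ℂ ((T' - T) x) y‖ ≤
      4 * c * ‖defectOp T x‖ * ‖defectOp (adjoint T) y‖ := by
  have first : ‖inner ℂ (defectOp (adjoint T) (T' x))
      (defectOp (adjoint T) y)‖ ≤
      2 * c * ‖defectOp T x‖ * ‖defectOp (adjoint T) y‖ := by
    refine (norm_inner_le_norm _ _).trans ?_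
    gcongr
    exact h.norm_defectOp_adjoint_apply_le hT hT' hc hTT' hqT x
  have second : ‖inner ℂ ((1 - adjoint T * T') x)
      (adjoint T y)‖ ≤
      2 * c * ‖defectOp T x‖ * ‖defectOp (adjoint T) y‖ := by
    refine (h.norm_inner_one_sub_adjoint_mul_le hT hT' (by linarith) hTT' hqT x _).trans ?_
    gcongr
    simpa only [adjoint_adjoint] using
      norm_defectOp_adjoint_apply_le (norm_adjoint_le_one hT) y
  rw [sub_apply_eq_defectOp_sub hT, inner_sub_left, inner_defectOp_left, ← adjoint_inner_right T]
  refine (norm_sub_le_of_le first second).trans_eq ?_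
  ring

theorem shmulyanEquivalent (h : PoissonDominated c T T') (hT : ‖T‖ ≤ 1) (hT' : ‖T'‖ ≤ 1)
    (hc : 1 ≤ c) (hTT' : DoublyCommute T T') (hqT : IsQuasiNormal T) :
    ShmulyanEquivalent T T' := by
  have sub_le := h.norm_inner_sub_le hT hT' hc hTT' hqT
  refine ⟨shmulyanDominated_of_norm_inner_le hT' (C := 4 * c * c * c) (by positivity) fun x y => ?_,
    shmulyanDominated_of_norm_inner_le hT (by positivity) sub_le⟩
  calc ‖inner ℂ ((T - T') x) y‖ = ‖inner ℂ ((T' - T) x) y‖ := by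
        rw [← neg_sub T' T, neg_apply, inner_neg_left, norm_neg]
    _ ≤ 4 * c * ‖defectOp T x‖ * ‖defectOp (adjoint T) y‖ := sub_le x y
    _ ≤ 4 * c * (c * ‖defectOp T' x‖) *
          (c * ‖defectOp (adjoint T') y‖) := by
        gcongr
        · exact h.norm_defectOp_le hT hT' hc x
        · exact h.adjoint.norm_defectOp_le (norm_adjoint_le_one hT) (norm_adjoint_le_one hT') hc y
    _ = 4 * c * c * c * ‖defectOp T' x‖ * ‖defectOp (adjoint T') y‖ := by ring

end PoissonDominated

theorem HarnackDominated.shmulyanEquivalent (h : HarnackDominated T T') (hT : ‖T‖ ≤ 1)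
    (hT' : ‖T'‖ ≤ 1) (hTT' : DoublyCommute T T') (hqT : IsQuasiNormal T) :
    ShmulyanEquivalent T T' := by
  obtain ⟨c, hc, hP⟩ := h.exists_poissonDominated hT hT'
  exact hP.shmulyanEquivalent hT hT' hc hTT' hqT

theorem isQuasiNormal_of_isStarNormal (hT : IsStarNormal T) : IsQuasiNormal T :=
  hT.star_comm_self.symm.mul_right (Commute.refl T)

end ShmulyanOfHarnack

theorem mainTheorem2_general {H : Type*} [NormedAddCommGroup H] [InnerProductSpace ℂ H]
    [CompleteSpace H] :
    (∀ T T' : H →L[ℂ] H, ‖T‖ ≤ 1 → ‖T'‖ ≤ 1 → DoublyCommute T T' → IsQuasiNormal T →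
      HarnackDominated T T' → ShmulyanEquivalent T T' ∧ HarnackEquivalent T T') ∧
    (∀ T T' : H →L[ℂ] H, ‖T‖ ≤ 1 → ‖T'‖ ≤ 1 → Commute T T' → IsStarNormal T →
      HarnackDominated T T' → ShmulyanEquivalent T T' ∧ HarnackEquivalent T T') := by
  have quasiNormal (T T' : H →L[ℂ] H) (hT : ‖T‖ ≤ 1) (hT' : ‖T'‖ ≤ 1) (hTT' : DoublyCommute T T')
      (hqT : IsQuasiNormal T) (h : HarnackDominated T T') :
      ShmulyanEquivalent T T' ∧ HarnackEquivalent T T' :=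
    have hS := h.shmulyanEquivalent hT hT' hTT' hqT
    ⟨hS, hS.harnackEquivalent hT hT'⟩
  exact ⟨quasiNormal, fun T T' hT hT' hcomm hn => quasiNormal T T' hT hT'
    (.of_commute hn hcomm) (isQuasiNormal_of_isStarNormal hn)⟩

theorem mainTheorem2 {H : Type*} [NormedAddCommGroup H] [InnerProductSpace ℂ H] [CompleteSpace H] :
    (∀ T T' : H →L[ℂ] H, ‖T‖ ≤ 1 → ‖T'‖ ≤ 1 → DoublyCommute T T' → IsQuasiNormal T →
      HarnackDominated T T' → ShmulyanEquivalent T T' ∧ HarnackEquivalent T T') ∧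
    (∀ T T' : H →L[ℂ] H, ‖T‖ ≤ 1 → ‖T'‖ ≤ 1 → Commute T T' → IsStarNormal T → IsStarNormal T' →
      HarnackDominated T T' → ShmulyanEquivalent T T' ∧ HarnackEquivalent T T') :=
  ⟨mainTheorem2_general.1, fun T T' hT hT' hcomm hn _ =>
    mainTheorem2_general.2 T T' hT hT' hcomm hn⟩
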